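/- Let $k\ge 1$ and $n\ge 2$ be integers, let $\mathbb F_q$ be a finite field with $q$ elements, and let $d=\gcd(k,q-1)$. Call a square matrix over a field $K$ \emph{split semisimple} (diagonalizable) if its minimal polynomial is a product of distinct monic polynomials of degree $1$ in $K[x]$. (1) If $q\ge (d-1)^4+6d$, then $$M_n(\mathbb F_q)=\{A^k+B^k \mid A,B\in M_n(\mathbb F_q)\ \text{split semisimple}\}.$$ (2) In particular, if $q\ge (k-1)^4+6k$, then every matrix in $M_n(\mathbb F_q)$ is of the form $A^k+B^k$ with $A,B\in M_n(\mathbb F_q)$. -/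

import Mathlib

namespace MatrixWaring

open Polynomial in
/-- A square matrix over a field is split semisimple (diagonalizable) if its minimal polynomial
is a product of distinct monic polynomials of degree one. -/
def SplitSemisimple {K : Type*} [Field K] {n : ℕ} (A : Matrix (Fin n) (Fin n) K) : Prop :=
  ∃ S : Finset K, minpoly K A = ∏ a ∈ S, (X - C a)

/-- The set of sums of two `k`-th powers of `n × n` matrices over `K`. -/
def sumsTwoPowers (k n : ℕ) (K : Type*) [Field K] : Set (Matrix (Fin n) (Fin n) K) :=
  {M | ∃ A B : Matrix (Fin n) (Fin n) K, M = A ^ k + B ^ k}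

/-- The set of sums of two `k`-th powers of split semisimple `n × n` matrices over `K`. -/
def sumsTwoPowersSS (k n : ℕ) (K : Type*) [Field K] : Set (Matrix (Fin n) (Fin n) K) :=
  {M | ∃ A B : Matrix (Fin n) (Fin n) K,
    SplitSemisimple A ∧ SplitSemisimple B ∧ M = A ^ k + B ^ k}

end MatrixWaring

/-! It suffices to write a matrix as a sum of two diagonalizable matrices whose eigenvalues are
`k`-th powers: if `r` is a polynomial picking a `k`-th root in `F` of each eigenvalue, then `r(A)`
is split semisimple with `r(A) ^ k = A`.

The arithmetic input is `exists_pow_add_pow_eq`: every `c ≠ 0` is `α + β` with `α, β` nonzero `k`-th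
powers and `α ≠ 1`. This is a Jacobi sum count, with main term `q - 2` and error of order `d² √q`,
which explains a hypothesis of order `d⁴`.

The linear algebra uses only this property and the fact that `0` and `1` are powers. By the
structure theorem one may take multiplication by `X` on `F[X]/(f)`. In a Newton basis it is
Hessenberg with ones below the diagonal, and the diagonal can be any sequence with the right trace.
Take diagonal entries that are sums of two elements of `{0, 1}`, except the last, which absorbs the
trace and is `α + β`. The subdiagonal ones are then dealt alternately to the two summands, so that
each summand breaks into blocks with distinct eigenvalues. -/

namespace MatrixWaring

/-! ### Sums of two `k`-th powers in a finite field, by Jacobi sums. -/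

section PowerSums

/-- The detector of `d`-th powers is supported where `χ` is trivial. -/
lemma sum_range_pow_mulChar_eq_zero {F : Type*} [Field F] {d : ℕ} {χ : MulChar F ℂ} (hχ : orderOf χ = d) {u : F}
    (hu : χ u ≠ 1) : ∑ j ∈ Finset.range d, (χ ^ j) u = 0 := by
  by_cases hu0 : u = 0
  · simp [hu0, MulChar.map_zero]
  have h1 : ∀ j, (χ ^ j) u = (χ u) ^ j := fun j => by
    have := MulChar.pow_apply_coe χ j (Units.mk0 u hu0)
    simpa using this
  simp_rw [h1]
  rw [geom_sum_eq hu, ← h1, ← hχ, pow_orderOf_eq_one, MulChar.one_apply (Ne.isUnit hu0)]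
  simp

variable {F : Type*} [Field F] [Fintype F]

lemma norm_mulChar_apply_le_one (χ : MulChar F ℂ) (a : F) : ‖χ a‖ ≤ 1 := by
  by_cases ha : a = 0
  · simp [ha, MulChar.map_zero]
  · have h : (χ a) ^ (Fintype.card F - 1) = 1 := by
      rw [← map_pow, FiniteField.pow_card_sub_one_eq_one a ha, map_one]
    refine (Complex.norm_eq_one_of_pow_eq_one h ?_).le
    have := Fintype.one_lt_card (α := F)
    omega

/-- Inverse characters are complex conjugates, so the identity `J(χ, φ) J(χ⁻¹, φ⁻¹) = q` says `|J|²
= q`. -/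
lemma norm_jacobiSum_eq_sqrt {χ φ : MulChar F ℂ} (hχ : χ ≠ 1) (hφ : φ ≠ 1) (hχφ : χ * φ ≠ 1) :
    ‖jacobiSum χ φ‖ = √(Fintype.card F) := by
  have hchar : ringChar ℂ ≠ ringChar F := by
    rw [ringChar.eq_zero]
    exact (CharP.ringChar_ne_zero_of_finite F).symm
  have h := jacobiSum_mul_jacobiSum_inv hchar hχ hφ hχφ
  have hs : jacobiSum χ⁻¹ φ⁻¹ = star (jacobiSum χ φ) := by
    simp only [jacobiSum, star_sum, star_mul', MulChar.star_apply']
  rw [hs] at h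
  have h2 := congrArg norm h
  rw [norm_mul, norm_star, Complex.norm_natCast] at h2
  rw [← h2, Real.sqrt_mul_self (norm_nonneg _)]

lemma norm_jacobiSum_one_le {χ : MulChar F ℂ} (hχ : χ ≠ 1) : ‖jacobiSum 1 χ‖ ≤ 1 := by
  rw [jacobiSum_one_nontrivial hχ]; simp

lemma norm_jacobiSum_inv_le {χ : MulChar F ℂ} (hχ : χ ≠ 1) : ‖jacobiSum χ χ⁻¹‖ ≤ 1 := by
  rw [jacobiSum_nontrivial_inv hχ, norm_neg]
  exact norm_mulChar_apply_le_one _ _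

/-- If `χ` has order `d`, then its kernel consists of `d`-th powers. -/
lemma exists_pow_eq_of_mulChar_apply_eq_one {d : ℕ} {χ : MulChar F ℂ} (hχ : orderOf χ = d)
    {u : F} (hu : χ u = 1) : ∃ x : F, x ^ d = u := by
  have hu0 : u ≠ 0 := by
    rintro rfl
    simp [MulChar.map_zero] at hu
  obtain ⟨g, hg⟩ := IsCyclic.exists_generator (α := Fˣ)
  obtain ⟨e, he⟩ := (Subgroup.mem_zpowers_iff).1 (hg (Units.mk0 u hu0))
  -- A character of a cyclic group is determined by its value at a generator `g`, so `χ g` has the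
  -- same order `d` as `χ`.
  have hd : ∀ m : ℤ, (χ.toUnitHom g) ^ m = 1 → (d : ℤ) ∣ m := by
    intro m hm
    have : χ ^ m = 1 := by
      rw [← MulChar.mulEquivToUnitHom.injective.eq_iff, map_one, map_zpow]
      ext x
      obtain ⟨j, rfl⟩ := (Subgroup.mem_zpowers_iff).1 (hg x)
      have h' : (MulChar.mulEquivToUnitHom χ) g ^ m = 1 := hm
      rw [map_zpow, MonoidHom.zpow_apply, h']
      simp
    rw [← hχ]
    exact orderOf_dvd_iff_zpow_eq_one.2 this
  obtain ⟨j, hj⟩ := hd e (by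
    rw [← map_zpow, he]
    ext
    simpa using hu)
  refine ⟨((g ^ j : Fˣ) : F), ?_⟩
  rw [← Units.val_pow_eq_pow_val, ← zpow_natCast, ← zpow_mul, mul_comm, ← hj, he]
  rfl

lemma sum_mulChar_mul_sub (χ φ : MulChar F ℂ) {c : F} (hc : c ≠ 0) :
    ∑ u : F, χ u * φ (c - u) = (χ * φ) c * jacobiSum χ φ := by
  rw [jacobiSum, ← Equiv.sum_comp (Equiv.mulLeft₀ c hc), Finset.mul_sum]
  refine Finset.sum_congr rfl fun x _ => ?_
  have : c - c * x = c * (1 - x) := by ring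
  change χ (c * x) * φ (c - c * x) = _
  simp only [this, map_mul, MulChar.mul_apply]
  ring

/-- Two terms are degenerate and have norm at most `1`: `j = 0` (trivial character) and `j = d - i`
(inverse character). The other `d - 2` have norm `√q`. -/
lemma sum_norm_jacobiSum_le {d : ℕ} {χ : MulChar F ℂ} (hχ : orderOf χ = d) {i : ℕ}
    (hi : 0 < i) (hid : i < d) :
    ∑ j ∈ Finset.range d, ‖jacobiSum (χ ^ i) (χ ^ j)‖ ≤
      2 + ((d : ℝ) - 2) * √(Fintype.card F) := by
  set s := √(Fintype.card F : ℝ)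
  have hpow : ∀ m, 0 < m → m < d → χ ^ m ≠ 1 := fun m h0 hm =>
    pow_ne_one_of_lt_orderOf h0.ne' (hχ ▸ hm)
  have hb : ∀ j ∈ Finset.range d, ‖jacobiSum (χ ^ i) (χ ^ j)‖ ≤
      s + (if j = 0 then 1 - s else 0) + (if j = d - i then 1 - s else 0) := by
    intro j hj
    rw [Finset.mem_range] at hj
    by_cases h0 : j = 0
    · have : ¬ (j = d - i) := by omega
      rw [if_pos h0, if_neg this, h0, pow_zero, jacobiSum_comm]
      linarith [norm_jacobiSum_one_le (hpow i hi hid)]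
    · by_cases h1 : j = d - i
      · rw [if_neg h0, if_pos h1]
        have : χ ^ j = (χ ^ i)⁻¹ := by
          rw [eq_inv_iff_mul_eq_one, ← pow_add, h1, Nat.sub_add_cancel hid.le, ← hχ,
            pow_orderOf_eq_one]
        rw [this]
        linarith [norm_jacobiSum_inv_le (hpow i hi hid)]
      · rw [if_neg h0, if_neg h1, norm_jacobiSum_eq_sqrt (hpow i hi hid) (hpow j (by omega) hj)]
        · simp [s]
        · rw [← pow_add]
          intro h
          have := orderOf_dvd_of_pow_eq_one h
          rw [hχ] at this
          obtain ⟨t, ht⟩ := this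
          have : t < 2 := by
            by_contra! h2
            have : d * 2 ≤ d * t := Nat.mul_le_mul_left _ h2
            omega
          interval_cases t <;> omega
  refine (Finset.sum_le_sum hb).trans (le_of_eq ?_)
  rw [Finset.sum_add_distrib, Finset.sum_add_distrib, Finset.sum_ite_eq', Finset.sum_ite_eq',
    if_pos (Finset.mem_range.2 (by omega)), if_pos (Finset.mem_range.2 (by omega))]
  simp
  ring

/-- A lower bound on the number of representations of `c ≠ 0` as a sum of two elements
on which `χ` is trivial, in contrapositive form. -/
lemma card_le_of_unique_representation {d : ℕ} (hd : 0 < d) {χ : MulChar F ℂ}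
    (hχ : orderOf χ = d) {c : F} (hc : c ≠ 0)
    (h : ∀ u : F, χ u = 1 → χ (c - u) = 1 → u = 1) :
    (Fintype.card F : ℝ) - 2 ≤
      d ^ 2 + 3 * ((d : ℝ) - 1) + ((d : ℝ) - 1) * ((d : ℝ) - 2) * √(Fintype.card F) := by
  set s := √(Fintype.card F : ℝ)
  set I : F → ℂ := fun u => ∑ j ∈ Finset.range d, (χ ^ j) u with hI
  have hIle : ∀ u, ‖I u‖ ≤ d := fun u => by
    refine (norm_sum_le _ _).trans ?_
    refine (Finset.sum_le_sum fun j _ => norm_mulChar_apply_le_one (χ ^ j) u).trans ?_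
    simp
  -- `I` is supported where `χ = 1`, so only `u = 1` can contribute, and `‖I‖ ≤ d`.
  have hS : ‖∑ u : F, I u * I (c - u)‖ ≤ d ^ 2 := by
    rw [Finset.sum_eq_single_of_mem (1 : F) (Finset.mem_univ _)]
    · rw [norm_mul, sq]
      exact mul_le_mul (hIle _) (hIle _) (norm_nonneg _) (by positivity)
    · intro u _ hu
      by_cases h1 : χ u = 1
      · have h2 : χ (c - u) ≠ 1 := fun h2 => hu (h u h1 h2)
        simp [hI, sum_range_pow_mulChar_eq_zero hχ h2]
      · simp [hI, sum_range_pow_mulChar_eq_zero hχ h1]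
  have hE : ∑ u : F, I u * I (c - u) = ∑ i ∈ Finset.range d, ∑ j ∈ Finset.range d,
      (χ ^ i * χ ^ j) c * jacobiSum (χ ^ i) (χ ^ j) := by
    simp_rw [hI, Finset.sum_mul_sum]
    rw [Finset.sum_comm]
    refine Finset.sum_congr rfl fun i _ => ?_
    rw [Finset.sum_comm]
    exact Finset.sum_congr rfl fun j _ => sum_mulChar_mul_sub _ _ hc
  obtain ⟨e, rfl⟩ : ∃ e, d = e + 1 := ⟨d - 1, by omega⟩
  rw [hE, Finset.sum_range_succ', Finset.sum_range_succ'] at hS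
  set X := ∑ i ∈ Finset.range e, ∑ j ∈ Finset.range (e + 1),
      (χ ^ (i + 1) * χ ^ j) c * jacobiSum (χ ^ (i + 1)) (χ ^ j)
  set Y := ∑ j ∈ Finset.range e,
      (χ ^ 0 * χ ^ (j + 1)) c * jacobiSum (χ ^ 0) (χ ^ (j + 1))
  have hterm : ∀ i j : ℕ, ‖(χ ^ i * χ ^ j) c * jacobiSum (χ ^ i) (χ ^ j)‖ ≤
      ‖jacobiSum (χ ^ i) (χ ^ j)‖ := fun i j => by
    rw [norm_mul]
    exact mul_le_of_le_one_left (norm_nonneg _) (norm_mulChar_apply_le_one _ _)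
  have hX : ‖X‖ ≤ e * (2 + (((e + 1 : ℕ) : ℝ) - 2) * s) := by
    refine (norm_sum_le _ _).trans ?_
    refine (Finset.sum_le_sum (g := fun _ => 2 + (((e + 1 : ℕ) : ℝ) - 2) * s) ?_).trans ?_
    · intro i hi
      rw [Finset.mem_range] at hi
      refine (norm_sum_le _ _).trans ((Finset.sum_le_sum fun j _ => hterm _ _).trans ?_)
      exact sum_norm_jacobiSum_le hχ (by omega) (by omega)
    · simp [mul_add]
  have hY : ‖Y‖ ≤ e := by
    refine (norm_sum_le _ _).trans ?_
    refine (Finset.sum_le_sum (g := fun _ => (1 : ℝ)) ?_).trans ?_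
    · intro j hj
      rw [Finset.mem_range] at hj
      refine (hterm _ _).trans ?_
      rw [pow_zero]
      exact norm_jacobiSum_one_le (pow_ne_one_of_lt_orderOf (by omega) (by omega))
    · simp
  -- The main term: the trivial character vanishes at `0`, so `J(1, 1)` counts the `x ≠ 0, 1`.
  have hZ : (χ ^ 0 * χ ^ 0) c * jacobiSum (χ ^ 0) (χ ^ 0) = ((Fintype.card F : ℝ) - 2 : ℝ) := by
    rw [pow_zero, mul_one, MulChar.one_apply (Ne.isUnit hc), jacobiSum_one_one]
    simp
  rw [hZ] at hS
  have hW : (Fintype.card F : ℝ) - 2 ≤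
      ‖(((Fintype.card F : ℝ) - 2 : ℝ) : ℂ)‖ := by
    rw [Complex.norm_real]
    exact Real.le_norm_self _
  set Z := (((Fintype.card F : ℝ) - 2 : ℝ) : ℂ)
  have htri : ‖Z‖ ≤ ‖X + (Y + Z)‖ + ‖X‖ + ‖Y‖ := by
    calc ‖Z‖ = ‖(X + (Y + Z)) - X - Y‖ := by congr 1; ring
      _ ≤ _ := (norm_sub_le _ _).trans (add_le_add_left (norm_sub_le _ _) _)
  push_cast at *
  nlinarith

lemma power_bound_lt {q d : ℕ} (hd : 0 < d) (hq : (d - 1) ^ 4 + 6 * d ≤ q) :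
    (d : ℝ) ^ 2 + 3 * ((d : ℝ) - 1) + ((d : ℝ) - 1) * ((d : ℝ) - 2) * √q < (q : ℝ) - 2 := by
  obtain ⟨D, rfl⟩ : ∃ D, d = D + 1 := ⟨d - 1, by omega⟩
  have hq' : ((D : ℝ)) ^ 4 + 6 * (D + 1) ≤ q := by
    rw [Nat.add_sub_cancel] at hq
    exact_mod_cast hq
  have hs : √(q : ℝ) ^ 2 = q := Real.sq_sqrt (by positivity)
  set s := √(q : ℝ)
  have hs0 : 0 ≤ s := Real.sqrt_nonneg _
  rw [← hs] at hq' ⊢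
  have hD0 : (0 : ℝ) ≤ D := by positivity
  have hsD : (D : ℝ) ^ 2 ≤ s := by
    refine le_of_sq_le_sq ?_ hs0
    nlinarith
  push_cast
  by_cases hD : 3 ≤ D
  · have hD3 : (3 : ℝ) ≤ D := by exact_mod_cast hD
    -- From `(s - D²)(s + D²) ≥ 6(D + 1)` and `s + D² ≤ 2s`. The slack left at the end is `D³ - D² -
    -- 2D = D(D - 2)(D + 1)`, hence the separate treatment of `D ≤ 2`.
    have h1 : 3 * (D : ℝ) + 3 ≤ s * (s - D ^ 2) := by nlinarith
    have h2 : (D : ℝ) * D ^ 2 ≤ D * s := by gcongr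
    have h3 : 0 < (D : ℝ) * (D - 2) * (D + 1) := by
      have : (0 : ℝ) < D - 2 := by linarith
      positivity
    nlinarith
  · have : D < 3 := by omega
    interval_cases D
    · norm_num at *; nlinarith
    · norm_num at *; nlinarith
    · norm_num at *
      have : (5.8 : ℝ) ≤ s := by nlinarith
      nlinarith

/-- Bézout: the gcd is `k a + (q - 1) b`, and `x ^ (q - 1) = 1`, so `y = x ^ a` works. -/
lemma exists_pow_gcd_eq_pow (k : ℕ) (x : F) (hx : x ≠ 0) :
    ∃ y : F, y ^ k = x ^ Nat.gcd k (Fintype.card F - 1) := by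
  classical
  refine ⟨((Units.mk0 x hx ^ Nat.gcdA k (Fintype.card F - 1) : Fˣ) : F), ?_⟩
  have h1 : (Units.mk0 x hx) ^ (Fintype.card F - 1) = 1 := by
    ext
    simpa using FiniteField.pow_card_sub_one_eq_one x hx
  have h2 : (Units.mk0 x hx ^ Nat.gcdA k (Fintype.card F - 1)) ^ k =
      Units.mk0 x hx ^ Nat.gcd k (Fintype.card F - 1) := by
    conv_rhs => rw [← zpow_natCast, Nat.gcd_eq_gcd_ab, zpow_add, zpow_mul _ ((_ - 1 : ℕ) : ℤ),
      zpow_natCast _ (_ - 1), h1, one_zpow, mul_one, mul_comm (k : ℤ), zpow_mul, zpow_natCast]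
  simpa using congrArg Units.val h2

/-- Every nonzero element is a sum of two nonzero `k`-th powers, the first one different from `1`,
as soon as the field is large compared with `gcd k (q - 1)`. -/
theorem exists_pow_add_pow_eq {k : ℕ} (hk : 1 ≤ k)
    (hq : (Nat.gcd k (Fintype.card F - 1) - 1) ^ 4 + 6 * Nat.gcd k (Fintype.card F - 1)
        ≤ Fintype.card F) {c : F} (hc : c ≠ 0) :
    ∃ x y : F, x ≠ 0 ∧ y ≠ 0 ∧ x ^ k ≠ 1 ∧ x ^ k + y ^ k = c := by
  set d := Nat.gcd k (Fintype.card F - 1) with hd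
  have hd0 : 0 < d := Nat.gcd_pos_of_pos_left _ hk
  obtain ⟨χ, hχ⟩ := MulChar.exists_mulChar_orderOf F (Nat.gcd_dvd_right k (Fintype.card F - 1))
    (Complex.isPrimitiveRoot_exp d hd0.ne')
  have key : ∃ u : F, χ u = 1 ∧ χ (c - u) = 1 ∧ u ≠ 1 := by
    by_contra! hcon
    exact (power_bound_lt hd0 hq).not_ge (card_le_of_unique_representation hd0 hχ hc hcon)
  have hroot : ∀ u : F, χ u = 1 → ∃ x : F, x ≠ 0 ∧ x ^ k = u := by
    intro u hu
    have hu0 : u ≠ 0 := by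
      rintro rfl
      simp [MulChar.map_zero] at hu
    obtain ⟨y, rfl⟩ := exists_pow_eq_of_mulChar_apply_eq_one hχ hu
    obtain ⟨x, hx⟩ := exists_pow_gcd_eq_pow k y (fun h => hu0 (by rw [h, zero_pow hd0.ne']))
    refine ⟨x, fun h => hu0 ?_, hx⟩
    rw [← hx, h, zero_pow (by omega)]
  obtain ⟨u, hu, hcu, hu1⟩ := key
  obtain ⟨x, hx0, rfl⟩ := hroot u hu
  obtain ⟨y, hy0, hy⟩ := hroot _ hcu
  exact ⟨x, y, hx0, hy0, hu1, by rw [hy]; ring⟩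

end PowerSums

/-! ### Endomorphisms as sums of two diagonalizable ones. -/

section Decomposition

open Polynomial

variable {F V W : Type*} [Field F] [AddCommGroup V] [Module F V] [AddCommGroup W] [Module F W]

/-- The endomorphism `A` is annihilated by the product of the `X - a` with `a ∈ P`, that is,
it is diagonalizable with all eigenvalues in `P`. -/
def DiagonalizableIn (P : Finset F) (A : Module.End F V) : Prop :=
  aeval A (∏ a ∈ P, (X - C a)) = 0

/-- The endomorphism `T` is a sum of two diagonalizable ones with eigenvalues in `P`. -/
def IsSumDiagonalizableIn (P : Finset F) (T : Module.End F V) : Prop :=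
  ∃ A B : Module.End F V, T = A + B ∧ DiagonalizableIn P A ∧ DiagonalizableIn P B

lemma aeval_intertwine {A : Module.End F V} {B : Module.End F W} (φ : V →ₗ[F] W)
    (h : ∀ v, φ (A v) = B (φ v)) (p : F[X]) (v : V) : φ (aeval A p v) = aeval B p (φ v) := by
  induction p using Polynomial.induction_on' with
  | add p q hp hq => simp [hp, hq]
  | monomial n a =>
    have hn : ∀ n : ℕ, φ ((A ^ n) v) = (B ^ n) (φ v) := fun n => by
      induction n with
      | zero => simp
      | succ n ih => rw [pow_succ', pow_succ', Module.End.mul_apply, h, ih, Module.End.mul_apply]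
    simp [aeval_monomial, hn, Module.algebraMap_end_apply]

lemma IsSumDiagonalizableIn.of_equiv {P : Finset F} {T : Module.End F V} {U : Module.End F W}
    (e : V ≃ₗ[F] W) (h : ∀ v, e (T v) = U (e v)) (hU : IsSumDiagonalizableIn P U) :
    IsSumDiagonalizableIn P T := by
  obtain ⟨A, B, hAB, hA, hB⟩ := hU
  have key : ∀ D : Module.End F W, DiagonalizableIn P D →
      DiagonalizableIn P (e.symm.toLinearMap ∘ₗ D ∘ₗ e.toLinearMap) := by
    intro D hD
    refine LinearMap.ext fun v => e.injective ?_
    have := aeval_intertwine (A := e.symm.toLinearMap ∘ₗ D ∘ₗ e.toLinearMap) (B := D)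
      e.toLinearMap (fun v => by simp) (∏ a ∈ P, (X - C a)) v
    rw [LinearEquiv.coe_coe] at this
    rw [this, show aeval D (∏ a ∈ P, (X - C a)) = 0 from hD]
    simp
  refine ⟨_, _, ?_, key A hA, key B hB⟩
  ext v
  apply e.injective
  simp [h, hAB]

lemma IsSumDiagonalizableIn.directSum {ι : Type*} [DecidableEq ι] {M : ι → Type*}
    [∀ i, AddCommGroup (M i)] [∀ i, Module F (M i)] {P : Finset F}
    {T : ∀ i, Module.End F (M i)} (h : ∀ i, IsSumDiagonalizableIn P (T i)) :
    IsSumDiagonalizableIn P (DirectSum.lmap T) := by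
  choose A B hAB hA hB using h
  have key : ∀ D : ∀ i, Module.End F (M i), (∀ i, DiagonalizableIn P (D i)) →
      DiagonalizableIn P (DirectSum.lmap D) := by
    intro D hD
    refine DirectSum.linearMap_ext F fun i => LinearMap.ext fun v => ?_
    have := aeval_intertwine (A := D i) (B := DirectSum.lmap D) (DirectSum.lof F ι M i)
      (fun v => by simp) (∏ a ∈ P, (X - C a)) v
    rw [LinearMap.comp_apply, ← this, show aeval (D i) (∏ a ∈ P, (X - C a)) = 0 from hD i]
    simp
  refine ⟨_, _, ?_, key A hA, key B hB⟩
  refine DirectSum.linearMap_ext F fun i => LinearMap.ext fun v => ?_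
  simp [hAB]

lemma aeval_prod_apply_eq_zero_of_subset {P S : Finset F} (hS : S ⊆ P) {A : Module.End F V}
    {v : V} (h : aeval A (∏ a ∈ S, (X - C a)) v = 0) : aeval A (∏ a ∈ P, (X - C a)) v = 0 := by
  classical
  rw [← Finset.prod_sdiff hS, map_mul, Module.End.mul_apply, h, map_zero]

lemma aeval_prod_apply_eq_zero_of_eigenvector {P : Finset F} {a : F} (ha : a ∈ P)
    {A : Module.End F V} {v : V} (h : A v = a • v) :
    aeval A (∏ a ∈ P, (X - C a)) v = 0 := by
  refine aeval_prod_apply_eq_zero_of_subset (Finset.singleton_subset_iff.2 ha) ?_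
  simp [h, Module.algebraMap_end_apply]

/-- The hypothesis is `(A - a)(A - b) v = 0`; this is the test for a basis vector heading a `2 × 2`
block with distinct eigenvalues. -/
lemma aeval_prod_apply_eq_zero_of_pair {P : Finset F} {a b : F} (ha : a ∈ P) (hb : b ∈ P)
    (hab : a ≠ b) {A : Module.End F V} {v : V} (h : A (A v - b • v) = a • (A v - b • v)) :
    aeval A (∏ a ∈ P, (X - C a)) v = 0 := by
  classical
  refine aeval_prod_apply_eq_zero_of_subset (S := {a, b}) (by
    simp [Finset.insert_subset_iff, ha, hb]) ?_
  rw [Finset.prod_pair hab]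
  simp [h, Module.algebraMap_end_apply]

/-- The prescribed diagonal of a cyclic endomorphism, apart from its last entry. -/
def chainDiag (m : ℕ) (ε : F) (i : ℕ) : F :=
  if Even (m - i) then 1 + (if i = 0 then ε else 1) else (if i = 0 then ε else 0)

/-- An endomorphism in Hessenberg form with diagonal `chainDiag m ε` followed by `α + β` splits
as an upper and a lower block triangular endomorphism, both diagonalizable. -/
lemma isSumDiagonalizableIn_of_chain {P : Finset F} (h0 : (0 : F) ∈ P) (h1 : (1 : F) ∈ P)
    {m : ℕ} (bas : Module.Basis (Fin (m + 1)) F V) {e : ℕ → V} (he : ∀ i, bas i = e i)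
    {α β ε : F} (hα : α ∈ P) (hα0 : α ≠ 0) (hα1 : α ≠ 1) (hβ : β ∈ P) (hβ0 : β ≠ 0)
    (hε : ε ∈ ({0, 1} : Set F)) {T : Module.End F V}
    (hT : ∀ i < m, T (e i) = chainDiag m ε i • e i + e (i + 1))
    (hTm : T (e m) - (α + β) • e m ∈ Submodule.span F (e '' Set.Iio m)) :
    IsSumDiagonalizableIn P T := by
  classical
  have hεP : ε ∈ P := by rcases hε with rfl | rfl <;> assumption
  set w := T (e m) - (α + β) • e m with hw
  -- The arrow `e i → e (i + 1)` goes to `A` when `m - i` is even and to `B` when it is odd, so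
  -- neither summand has two consecutive arrows. The last column `w` goes to `A`. The parity is
  -- counted from `m` so that the arrow into `e m` belongs to `B`.
  let A : Module.End F V := bas.constr F fun i =>
    if (i : ℕ) = m then α • e m + w
    else if Even (m - (i : ℕ)) then e i + e (i + 1)
    else (if (i : ℕ) = 0 then ε else 0) • e i
  let B : Module.End F V := bas.constr F fun i =>
    if (i : ℕ) = m then β • e m
    else if Even (m - (i : ℕ)) then (if (i : ℕ) = 0 then ε else 1) • e i
    else e (i + 1)
  have hA : ∀ i ≤ m, A (e i) = if i = m then α • e m + w
      else if Even (m - i) then e i + e (i + 1) else (if i = 0 then ε else 0) • e i := by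
    intro i hi
    have := bas.constr_basis F (fun i : Fin (m + 1) => if (i : ℕ) = m then α • e m + w
      else if Even (m - (i : ℕ)) then e i + e (i + 1)
      else (if (i : ℕ) = 0 then ε else 0) • e i) ⟨i, by omega⟩
    rwa [he] at this
  have hB : ∀ i ≤ m, B (e i) = if i = m then β • e m
      else if Even (m - i) then (if i = 0 then ε else 1) • e i else e (i + 1) := by
    intro i hi
    have := bas.constr_basis F (fun i : Fin (m + 1) => if (i : ℕ) = m then β • e m
      else if Even (m - (i : ℕ)) then (if (i : ℕ) = 0 then ε else 1) • e i
      else e (i + 1)) ⟨i, by omega⟩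
    rwa [he] at this
  have hpar : ∀ i < m, (Even (m - (i + 1)) ↔ ¬ Even (m - i)) := by
    intro i hi
    rw [show m - i = (m - (i + 1)) + 1 by omega, Nat.even_add_one, not_not]
  refine ⟨A, B, ?_, ?_, ?_⟩
  · refine bas.ext fun i => ?_
    rw [he, LinearMap.add_apply, hA i (by omega), hB i (by omega)]
    by_cases him : (i : ℕ) = m
    · rw [if_pos him, if_pos him, him, hw]
      module
    · rw [if_neg him, if_neg him, hT i (by omega), chainDiag]
      split_ifs <;> module
  -- On the span of the `e i` with `i < m`, `A` is idempotent. Since `(A - α) e m = w` lies in that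
  -- span, `A (A - 1) (A - α)` kills `e m`; here `α ≠ 0, 1` is needed.
  · have hlow : ∀ i < m, A (A (e i) - (1 : F) • e i) = (0 : F) • (A (e i) - (1 : F) • e i) := by
      intro i hi
      rw [hA i hi.le, if_neg hi.ne]
      by_cases hev : Even (m - i)
      · have him : i + 1 ≠ m := by
          rintro rfl
          simp at hev
        rw [if_pos hev, one_smul, add_sub_cancel_left, hA (i + 1) hi, if_neg him,
          if_neg (by rw [hpar i hi]; exact not_not.2 hev)]
        simp
      · have hAe := hA i hi.le
        rw [if_neg hi.ne, if_neg hev] at hAe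
        rw [if_neg hev, map_sub, map_smul, map_smul, hAe]
        split_ifs
        · rcases hε with rfl | h
          · simp
          · rw [Set.mem_singleton_iff] at h
            simp [h]
        · simp
    refine bas.ext fun i => ?_
    rw [he, LinearMap.zero_apply]
    by_cases him : (i : ℕ) = m
    · have hspan : ∀ x ∈ Submodule.span F (e '' Set.Iio m), A (A x - x) = 0 := by
        intro x hx
        have : Submodule.span F (e '' Set.Iio m) ≤ LinearMap.ker (A * (A - 1)) := by
          rw [Submodule.span_le]
          rintro _ ⟨i, hi, rfl⟩
          have := hlow i hi
          simpa using this
        simpa using this hx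
      rw [him]
      refine aeval_prod_apply_eq_zero_of_subset (S := {0, 1, α}) (by
        simp [Finset.insert_subset_iff, h0, h1, hα]) ?_
      rw [Finset.prod_insert (by simp [hα0.symm]), Finset.prod_pair hα1.symm]
      have := hspan w hTm
      simp only [map_mul, map_sub, aeval_X, Module.End.mul_apply, LinearMap.sub_apply, aeval_C,
        Module.algebraMap_end_apply, hA m le_rfl, if_true, zero_smul, add_sub_cancel_left,
        one_smul, sub_zero] at this ⊢
      exact this
    · exact aeval_prod_apply_eq_zero_of_pair h0 h1 zero_ne_one (hlow i (by omega))
  · refine bas.ext fun i => ?_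
    rw [he, LinearMap.zero_apply]
    have hi : (i : ℕ) ≤ m := by omega
    generalize (i : ℕ) = i at hi
    have hBi := hB i hi
    by_cases him : i = m
    · rw [if_pos him] at hBi
      exact aeval_prod_apply_eq_zero_of_eigenvector hβ (by rw [hBi, him])
    rw [if_neg him] at hBi
    by_cases hev : Even (m - i)
    · rw [if_pos hev] at hBi
      refine aeval_prod_apply_eq_zero_of_eigenvector ?_ hBi
      split_ifs <;> assumption
    rw [if_neg hev] at hBi
    -- `B` sends `e i` to an eigenvector of eigenvalue `1`, or `β` when `i + 1 = m`; both differ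
    -- from `0`.
    have hBs := hB (i + 1) (by omega)
    by_cases him' : i + 1 = m
    · rw [if_pos him', ← him'] at hBs
      exact aeval_prod_apply_eq_zero_of_pair hβ h0 hβ0 (by rw [hBi, zero_smul, sub_zero, hBs])
    · rw [if_neg him', if_pos ((hpar i (by omega)).2 hev), if_neg (by omega)] at hBs
      exact aeval_prod_apply_eq_zero_of_pair h1 h0 one_ne_zero
        (by rw [hBi, zero_smul, sub_zero, hBs])

/-- The Newton polynomials `∏ j < i, (X - d j)`. -/
noncomputable def newtonSequence (d : ℕ → F) : Polynomial.Sequence F where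
  elems' i := ∏ j ∈ Finset.range i, (X - C (d j))
  degree_eq' i := by simp [degree_prod]

lemma newtonSequence_apply (d : ℕ → F) (i : ℕ) :
    newtonSequence d i = ∏ j ∈ Finset.range i, (X - C (d j)) := rfl

lemma newtonSequence_monic (d : ℕ → F) (i : ℕ) : (newtonSequence d i).Monic := by
  rw [newtonSequence_apply]
  exact monic_prod_of_monic _ _ fun j _ => monic_X_sub_C _

lemma newtonSequence_span_degreeLT (d : ℕ → F) (m : ℕ) :
    Submodule.span F (newtonSequence d '' Set.Iio m) = degreeLT F m :=
  (newtonSequence d).span_degreeLT fun i _ => by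
    rw [(newtonSequence_monic d i).leadingCoeff]
    exact isUnit_one

/-- The image of a Newton sequence is a basis of the quotient by a monic polynomial. -/
lemma exists_basis_quotient_eq_newtonSequence {f : F[X]} (hf : f.Monic) {n : ℕ}
    (hn : f.natDegree = n) (d : ℕ → F) :
    ∃ bas : Module.Basis (Fin n) F (F[X] ⧸ Submodule.span F[X] {f}),
      ∀ i, bas i = (Submodule.span F[X] {f}).mkQ (newtonSequence d i) := by
  set N := Submodule.span F[X] {f}
  let π : F[X] →ₗ[F] F[X] ⧸ N := N.mkQ.restrictScalars F
  have hdeg : f.degree = n := by rw [degree_eq_natDegree hf.ne_zero, hn]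
  have hrange : Set.range (fun i : Fin n => newtonSequence d i) = newtonSequence d '' Set.Iio n := by
    ext p
    constructor
    · rintro ⟨i, rfl⟩
      exact ⟨i, i.2, rfl⟩
    · rintro ⟨i, hi, rfl⟩
      exact ⟨⟨i, hi⟩, rfl⟩
  have hli : LinearIndependent F fun i : Fin n => π (newtonSequence d i) := by
    refine LinearIndependent.map
      ((newtonSequence d).linearIndependent.comp _ Fin.val_injective) ?_
    change Disjoint (Submodule.span F (Set.range fun i : Fin n => newtonSequence d i)) _
    rw [hrange, newtonSequence_span_degreeLT, Submodule.disjoint_def]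
    intro p hp hpk
    have hpN : p ∈ N := (Submodule.Quotient.mk_eq_zero N).1 hpk
    obtain ⟨r, rfl⟩ := Submodule.mem_span_singleton.1 hpN
    rw [mem_degreeLT, smul_eq_mul] at hp
    by_contra hr
    have hdvd : f ∣ r * f := dvd_mul_left _ _
    exact (not_le.2 hp) (hdeg ▸ degree_le_of_dvd hdvd hr)
  have hspan : ⊤ ≤ Submodule.span F (Set.range fun i : Fin n => π (newtonSequence d i)) := by
    rintro x -
    obtain ⟨p, rfl⟩ := N.mkQ_surjective x
    have h1 : N.mkQ p = π (p %ₘ f) := by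
      change N.mkQ p = N.mkQ (p %ₘ f)
      rw [← sub_eq_zero, ← map_sub, N.mkQ_apply, Submodule.Quotient.mk_eq_zero,
        Submodule.mem_span_singleton]
      refine ⟨p /ₘ f, ?_⟩
      conv_rhs => enter [1]; rw [← modByMonic_add_div p f]
      rw [smul_eq_mul]
      ring
    have h2 : p %ₘ f ∈ Submodule.span F (newtonSequence d '' Set.Iio n) := by
      rw [newtonSequence_span_degreeLT, mem_degreeLT, ← hdeg]
      exact degree_modByMonic_lt _ hf
    rw [h1, show (Set.range fun i : Fin n => π (newtonSequence d i)) =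
      π '' (newtonSequence d '' Set.Iio n) by rw [← hrange, ← Set.range_comp]; rfl,
      Submodule.span_image]
    exact Submodule.mem_map_of_mem h2
  exact ⟨Module.Basis.mk hli hspan, fun i => by rw [Module.Basis.mk_apply]; rfl⟩

/-- If the sum of the `d i` is the sum of the roots of `f`, then the last Newton polynomial
agrees with `f` in the two leading coefficients. -/
lemma newtonSequence_sub_mem_degreeLT {f : F[X]} (hf : f.Monic) {m : ℕ}
    (hm : f.natDegree = m + 1) {d : ℕ → F}
    (hd : ∑ i ∈ Finset.range (m + 1), d i = -f.nextCoeff) :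
    newtonSequence d (m + 1) - f ∈ degreeLT F m := by
  have hnat : (newtonSequence d (m + 1)).natDegree = m + 1 := (newtonSequence d).natDegree_eq _
  have hnext : (newtonSequence d (m + 1)).nextCoeff = f.nextCoeff := by
    rw [newtonSequence_apply, prod_X_sub_C_nextCoeff, hd, neg_neg]
  rw [nextCoeff_of_natDegree_pos (by omega), nextCoeff_of_natDegree_pos (by omega), hnat, hm,
    Nat.add_sub_cancel] at hnext
  rw [mem_degreeLT, degree_lt_iff_coeff_zero]
  intro j hj
  rw [coeff_sub]
  rcases hj.eq_or_lt with rfl | hj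
  · rw [hnext, sub_self]
  rcases (Nat.succ_le_of_lt hj).eq_or_lt with rfl | hj
  · have h1 := (newtonSequence_monic d (m + 1)).coeff_natDegree
    have h2 := hf.coeff_natDegree
    rw [hnat] at h1
    rw [hm] at h2
    rw [Nat.succ_eq_add_one, h1, h2, sub_self]
  · rw [coeff_eq_zero_of_natDegree_lt (by omega), coeff_eq_zero_of_natDegree_lt (by omega),
      sub_zero]

/-- Multiplication by `X` on a cyclic module is a sum of two diagonalizable endomorphisms with
eigenvalues in `P`, provided that `P` satisfies a mild additive condition. -/
lemma isSumDiagonalizableIn_quotient {P : Finset F} (h0 : (0 : F) ∈ P) (h1 : (1 : F) ∈ P)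
    (hP : ∀ c : F, c ≠ 0 → ∃ α ∈ P, ∃ β ∈ P, α ≠ 0 ∧ α ≠ 1 ∧ β ≠ 0 ∧ α + β = c)
    {f : F[X]} (hf : f.Monic) :
    IsSumDiagonalizableIn P
      (Algebra.lsmul F F (F[X] ⧸ Submodule.span F[X] {f}) (X : F[X])) := by
  set N := Submodule.span F[X] {f}
  have hfN : N.mkQ f = 0 := (Submodule.Quotient.mk_eq_zero N).2 (Submodule.mem_span_singleton_self f)
  have hX : ∀ x : F[X] ⧸ N, Algebra.lsmul F F (F[X] ⧸ N) (X : F[X]) x = (X : F[X]) • x :=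
    fun _ => rfl
  obtain h | ⟨m, hm⟩ : f.natDegree = 0 ∨ ∃ m, f.natDegree = m + 1 := by
    cases f.natDegree <;> simp
  · have hf1 : f = 1 := hf.natDegree_eq_zero.1 h
    have hx : ∀ x : F[X] ⧸ N, x = 0 := by
      intro x
      obtain ⟨p, rfl⟩ := N.mkQ_surjective x
      have : p = p • f := by simp [hf1]
      rw [this, map_smul, hfN, smul_zero]
    exact ⟨0, 0, LinearMap.ext fun x => (hx _).trans (hx _).symm,
      LinearMap.ext fun x => (hx _).trans (hx _).symm,
      LinearMap.ext fun x => (hx _).trans (hx _).symm⟩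
  rcases Nat.eq_zero_or_pos m with rfl | hmpos
  · obtain ⟨α, hα, β, hβ, hαβ⟩ : ∃ α ∈ P, ∃ β ∈ P, α + β = -f.coeff 0 := by
      by_cases hc : -f.coeff 0 = 0
      · exact ⟨0, h0, 0, h0, by simp [hc]⟩
      · obtain ⟨α, hα, β, hβ, -, -, -, h⟩ := hP _ hc
        exact ⟨α, hα, β, hβ, h⟩
    have hfX : f = X - C (α + β) := by
      rw [hαβ, C_neg, sub_neg_eq_add]
      exact hf.eq_X_add_C hm
    refine ⟨α • 1, β • 1, ?_, ?_, ?_⟩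
    · refine LinearMap.ext fun x => ?_
      obtain ⟨p, rfl⟩ := N.mkQ_surjective x
      have : N.mkQ (p • f) = 0 := by rw [map_smul, hfN, smul_zero]
      rw [hfX, smul_eq_mul, show p * (X - C (α + β)) = (X : F[X]) • p - (α + β) • p by
        rw [smul_eq_mul, smul_eq_C_mul]; ring, map_sub, sub_eq_zero] at this
      rw [hX, ← map_smul, this, ← add_smul]
      rfl
    · exact LinearMap.ext fun x => aeval_prod_apply_eq_zero_of_eigenvector hα (by simp)
    · exact LinearMap.ext fun x => aeval_prod_apply_eq_zero_of_eigenvector hβ (by simp)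
  -- Only nonzero `c` can be split as `α + β`. Changing `ε` from `0` to `1` moves the remaining
  -- trace by `1`, so one of the two choices leaves it nonzero.
  · obtain ⟨ε, hε, hne⟩ : ∃ ε ∈ ({0, 1} : Set F),
        -f.nextCoeff - ∑ i ∈ Finset.range m, chainDiag m ε i ≠ 0 := by
      by_contra! hcon
      have e0 := hcon 0 (by simp)
      have e1 := hcon 1 (by simp)
      have hdiff : ∑ i ∈ Finset.range m, chainDiag m (1 : F) i =
          ∑ i ∈ Finset.range m, chainDiag m (0 : F) i + 1 := by
        obtain ⟨l, rfl⟩ : ∃ l, m = l + 1 := ⟨m - 1, by omega⟩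
        rw [Finset.sum_range_succ', Finset.sum_range_succ', add_assoc]
        congr 1
        simp only [chainDiag, if_true]
        split_ifs <;> ring
      rw [hdiff] at e1
      have : (1 : F) = 0 := by linear_combination e0 - e1
      exact one_ne_zero this
    obtain ⟨α, hα, β, hβ, hα0, hα1, hβ0, hαβ⟩ := hP _ hne
    let d : ℕ → F := fun i => if i = m then α + β else chainDiag m ε i
    have hd : ∑ i ∈ Finset.range (m + 1), d i = -f.nextCoeff := by
      rw [Finset.sum_range_succ, Finset.sum_congr rfl (g := chainDiag m ε)
        fun i hi => if_neg (Finset.mem_range.1 hi).ne, show d m = α + β from if_pos rfl, hαβ]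
      ring
    obtain ⟨bas, hbas⟩ := exists_basis_quotient_eq_newtonSequence hf hm d
    have hstep : ∀ i, (X : F[X]) • N.mkQ (newtonSequence d i) =
        d i • N.mkQ (newtonSequence d i) + N.mkQ (newtonSequence d (i + 1)) := by
      intro i
      have : newtonSequence d (i + 1) =
          (X : F[X]) • newtonSequence d i - C (d i) • newtonSequence d i := by
        rw [newtonSequence_apply, Finset.prod_range_succ, ← newtonSequence_apply]
        simp only [smul_eq_mul]
        ring
      rw [this, map_sub, map_smul, map_smul, ← algebraMap_eq, algebraMap_smul]
      abel
    refine isSumDiagonalizableIn_of_chain h0 h1 bas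
      (e := fun i => N.mkQ (newtonSequence d i)) hbas hα hα0 hα1 hβ hβ0 hε ?_ ?_
    · intro i hi
      rw [hX, hstep, show d i = chainDiag m ε i from if_neg hi.ne]
    · rw [hX, hstep, show d m = α + β from if_pos rfl, add_sub_cancel_left]
      -- Modulo `f` the last Newton polynomial equals its difference with `f`. The trace condition
      -- makes this of degree below `m`, so it involves only the earlier basis vectors.
      have hmem := newtonSequence_sub_mem_degreeLT hf hm hd
      rw [← newtonSequence_span_degreeLT d] at hmem
      have := Submodule.mem_map_of_mem (f := N.mkQ.restrictScalars F) hmem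
      rw [← Submodule.span_image, Set.image_image, LinearMap.restrictScalars_apply, map_sub, hfN,
        sub_zero] at this
      exact this

/-- Every endomorphism of a finite-dimensional space is a sum of two diagonalizable ones with
eigenvalues in `P`, provided that `P` satisfies a mild additive condition. -/
theorem isSumDiagonalizableIn_of_finite [Module.Finite F V] {P : Finset F}
    (h0 : (0 : F) ∈ P) (h1 : (1 : F) ∈ P)
    (hP : ∀ c : F, c ≠ 0 → ∃ α ∈ P, ∃ β ∈ P, α ≠ 0 ∧ α ≠ 1 ∧ β ≠ 0 ∧ α + β = c)
    (T : Module.End F V) : IsSumDiagonalizableIn P T := by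
  classical
  -- View `V` as an `F[X]`-module with `X` acting as `T`; it is torsion, hence a direct sum of
  -- cyclic modules.
  obtain ⟨ι, _, p, hp, e, ⟨φ⟩⟩ := Module.equiv_directSum_of_isTorsion
    (R := F[X]) (M := Module.AEval' T) (Module.AEval.isTorsion_of_finiteDimensional F V T)
  have hblock : ∀ i, IsSumDiagonalizableIn P
      (Algebra.lsmul F F (F[X] ⧸ Submodule.span F[X] {p i ^ e i}) (X : F[X])) := by
    intro i
    have hne : p i ^ e i ≠ 0 := pow_ne_zero _ (hp i).ne_zero
    have hspan : Submodule.span F[X] {p i ^ e i} = Submodule.span F[X] {normalize (p i ^ e i)} :=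
      Ideal.span_singleton_eq_span_singleton.2 (associated_normalize _)
    rw [hspan]
    exact isSumDiagonalizableIn_quotient h0 h1 hP (monic_normalize hne)
  refine (IsSumDiagonalizableIn.directSum hblock).of_equiv
    ((Module.AEval'.of T).trans (φ.restrictScalars F)) fun v => ?_
  have h1 : φ (Module.AEval'.of T (T v)) = (X : F[X]) • φ (Module.AEval'.of T v) := by
    rw [← map_smul, Module.AEval'.X_smul_of]
  have h2 : ∀ y : DirectSum ι fun i => F[X] ⧸ Submodule.span F[X] {p i ^ e i},
      (X : F[X]) • y = DirectSum.lmap (fun i =>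
        Algebra.lsmul F F (F[X] ⧸ Submodule.span F[X] {p i ^ e i}) (X : F[X])) y := by
    intro y
    refine DFinsupp.ext fun i => ?_
    rfl
  simp only [LinearEquiv.trans_apply, LinearEquiv.restrictScalars_apply]
  rw [h1, h2]

end Decomposition

/-! ### From eigenvalues that are `k`-th powers to `k`-th powers of matrices. -/

section Matrices

open Polynomial

variable {F : Type*} [Field F]

lemma aeval_eq_zero_of_forall_eval_eq_zero {R : Type*} [Ring R] [Algebra F R] {P : Finset F}
    {A : R} (hA : aeval A (∏ a ∈ P, (X - C a)) = 0) {p : F[X]} (hp : ∀ a ∈ P, p.eval a = 0) :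
    aeval A p = 0 := by
  have : ∏ a ∈ P, (X - C a) ∣ p := by
    refine Finset.prod_dvd_of_coprime ?_ fun a ha => dvd_iff_isRoot.2 (hp a ha)
    intro a _ b _ hab
    exact isCoprime_X_sub_C_of_isUnit_sub (sub_ne_zero.2 hab).isUnit
  obtain ⟨r, rfl⟩ := this
  rw [map_mul, hA, zero_mul]

/-- Over a finite field, a matrix fixed by the Frobenius power is split semisimple. -/
lemma splitSemisimple_of_pow_card_eq [Fintype F] {n : ℕ} {A : Matrix (Fin n) (Fin n) F}
    (hA : A ^ Fintype.card F = A) : SplitSemisimple A := by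
  classical
  set q := Fintype.card F
  have hq : 1 < q := Fintype.one_lt_card
  have hne : (X ^ q - X : F[X]) ≠ 0 := FiniteField.X_pow_card_sub_X_ne_zero F hq
  have hdvd : minpoly F A ∣ X ^ q - X := minpoly.dvd _ _ (by simp [hA])
  have hroots : (X ^ q - X : F[X]).roots = Finset.univ.val := FiniteField.roots_X_pow_card_sub_X F
  have hsplit : (X ^ q - X : F[X]).Splits := by
    rw [splits_iff_card_roots, hroots, FiniteField.X_pow_card_sub_X_natDegree_eq F hq]
    rfl
  have hnodup : (minpoly F A).roots.Nodup :=
    Multiset.nodup_of_le (roots.le_of_dvd hne hdvd) (hroots ▸ Finset.univ.nodup)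
  refine ⟨(minpoly F A).roots.toFinset, ?_⟩
  have hs : (minpoly F A).Splits := hsplit.of_dvd hne hdvd
  rw [Finset.prod, Multiset.toFinset_val, hnodup.dedup]
  exact hs.eq_prod_roots_of_monic (minpoly.monic (Matrix.isIntegral A))

/-- A matrix that is diagonalizable with `k`-th powers as eigenvalues is the `k`-th power of a
split semisimple matrix. -/
lemma exists_splitSemisimple_pow_eq [Fintype F] {k n : ℕ} {P : Finset F}
    (hP : ∀ a ∈ P, ∃ x : F, x ^ k = a) {A : Matrix (Fin n) (Fin n) F}
    (hA : aeval A (∏ a ∈ P, (X - C a)) = 0) :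
    ∃ B : Matrix (Fin n) (Fin n) F, SplitSemisimple B ∧ A = B ^ k := by
  classical
  choose! g hg using hP
  -- A polynomial choosing a `k`-th root `g a` of each `a ∈ P`. On `P` both `r ^ q - r` and `r ^ k -
  -- X` vanish, so both vanish at `A`.
  set r : F[X] := Lagrange.interpolate P id g
  have hr : ∀ a ∈ P, r.eval a = g a := fun a ha =>
    Lagrange.eval_interpolate_at_node g (Set.injOn_id _) ha
  refine ⟨aeval A r, splitSemisimple_of_pow_card_eq ?_, ?_⟩
  · have := aeval_eq_zero_of_forall_eval_eq_zero hA (p := r ^ Fintype.card F - r) fun a _ => by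
      rw [eval_sub, eval_pow, FiniteField.pow_card, sub_self]
    rwa [map_sub, map_pow, sub_eq_zero] at this
  · have := aeval_eq_zero_of_forall_eval_eq_zero hA (p := r ^ k - X) fun a ha => by
      rw [eval_sub, eval_pow, eval_X, hr a ha, hg a ha, sub_self]
    rw [map_sub, map_pow, aeval_X, sub_eq_zero] at this
    exact this.symm

/-- Every matrix is a sum of two `k`-th powers of split semisimple matrices as soon as the field
is large compared with `gcd k (q - 1)`. -/
theorem sumsTwoPowersSS_eq_univ [Fintype F] {k : ℕ} (hk : 1 ≤ k) (n : ℕ)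
    (hq : (Nat.gcd k (Fintype.card F - 1) - 1) ^ 4 + 6 * Nat.gcd k (Fintype.card F - 1)
        ≤ Fintype.card F) :
    sumsTwoPowersSS k n F = Set.univ := by
  classical
  refine Set.eq_univ_of_forall fun M => ?_
  set P : Finset F := Finset.univ.image fun x => x ^ k with hPdef
  have hmem : ∀ x : F, x ^ k ∈ P := fun x => Finset.mem_image_of_mem _ (Finset.mem_univ x)
  have hroot : ∀ a ∈ P, ∃ x : F, x ^ k = a := fun a ha => by simpa [hPdef] using ha
  have hP : ∀ c : F, c ≠ 0 → ∃ α ∈ P, ∃ β ∈ P, α ≠ 0 ∧ α ≠ 1 ∧ β ≠ 0 ∧ α + β = c := by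
    intro c hc
    obtain ⟨x, y, hx, hy, hx1, hxy⟩ := exists_pow_add_pow_eq hk hq hc
    exact ⟨_, hmem x, _, hmem y, pow_ne_zero _ hx, hx1, pow_ne_zero _ hy, hxy⟩
  obtain ⟨A, B, hAB, hA, hB⟩ := isSumDiagonalizableIn_of_finite (P := P)
    (by simpa [zero_pow (show k ≠ 0 by omega)] using hmem 0) (by simpa using hmem 1) hP
    (Matrix.toLinAlgEquiv' M)
  have key : ∀ D : Module.End F (Fin n → F), DiagonalizableIn P D →
      ∃ E : Matrix (Fin n) (Fin n) F, SplitSemisimple E ∧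
        Matrix.toLinAlgEquiv'.symm D = E ^ k := by
    intro D hD
    refine exists_splitSemisimple_pow_eq hroot ?_
    rw [aeval_algHom_apply, show aeval D (∏ a ∈ P, (X - C a)) = 0 from hD, map_zero]
  obtain ⟨A', hA', hA⟩ := key A hA
  obtain ⟨B', hB', hB⟩ := key B hB
  refine ⟨A', B', hA', hB', ?_⟩
  rw [← hA, ← hB, ← map_add, ← hAB, AlgEquiv.symm_apply_apply]

end Matrices

end MatrixWaring

theorem theorem1p7 (k n : ℕ) (hk : 1 ≤ k) (hn : 2 ≤ n)
    (F : Type*) [Field F] [Fintype F] :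
    ((Nat.gcd k (Fintype.card F - 1) - 1) ^ 4 + 6 * Nat.gcd k (Fintype.card F - 1)
        ≤ Fintype.card F →
      MatrixWaring.sumsTwoPowersSS k n F = Set.univ) ∧
    ((k - 1) ^ 4 + 6 * k ≤ Fintype.card F →
      MatrixWaring.sumsTwoPowers k n F = Set.univ) := by
  refine ⟨MatrixWaring.sumsTwoPowersSS_eq_univ hk n, fun h => ?_⟩
  have hle : Nat.gcd k (Fintype.card F - 1) ≤ k := Nat.gcd_le_left _ hk
  have hSS := MatrixWaring.sumsTwoPowersSS_eq_univ hk n (F := F) (le_trans (by gcongr) h)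
  refine Set.eq_univ_of_forall fun M => ?_
  obtain ⟨A, B, -, -, hM⟩ := hSS.symm ▸ Set.mem_univ M
  exact ⟨A, B, hM⟩
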